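/- Let $G$ be a finite group of even order and let $t$ be an involution of $G$ (an element of order $2$). Let $N$ be a non-trivial nilpotent subgroup of $G$, and suppose that $|C_G(x)|^3 < |G|$ for every non-identity element $x \in N$, where $C_G(x)$ denotes the centralizer of $x$ in $G$. Write $Z(N)$ for the center of $N$. Then: (i) if $N$ is Abelian, then $|N| < \sqrt{2}\,|C_G(t)|$; (ii) if $N$ is non-Abelian, then $$|N| < \sqrt{\frac{2|Z(N)|-1}{|Z(N)|-1}}\;|C_G(t)|.$$ -/

import Mathlib

/-!
Let `K` be the conjugacy class of `t`, of size `|G : C(t)|`, let `I(x)` be the set of all `u` with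
`u² = 1` that invert `x`, and let `b` be the integer part of the cube root of `|G|`. If `u ≠ v` in
`K` lie in the same coset of `N`, then `x = u⁻¹v` is a nontrivial element of `N` and `u ∈ I(x)`.
Hence `2|K| ≤ 2|G : N| + |N| max |I(x)|`. Here `|I(x)| ≤ |C(x)| ≤ b`, because `I(x)` lies in a coset
of `C(x)`, and `|N| ≤ b`, because `N` centralizes some `z ≠ 1` in `N`. As `b³ ≤ |G|`, this gives
`|K| ≤ (3/2) |G : N|`, which just misses the constant `√2`. A factor `3/4` in the error term
suffices, since `1 + (1/2)(3/4) = 11/8 < √2`.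

If `N` is not abelian, then `|I(x)| ≤ (3/4) b`: either `C(x)` is not abelian, and Miller's theorem
says that at most `3/4` of its elements are inverted by a given `u ∈ I(x)`, or `C(x)` is abelian and
is then a proper subgroup of `C(z)`. If `N` is abelian and properly contained in some `C(x)`, then
`|N| ≤ b/2`. In the remaining case `N = C(x)` for all `x ≠ 1` in `N`, and then all the sets `I(x)`
lie in a single coset of `N`, which gives `|K| ≤ |G : N| + |N| - 1`.
-/

section Pigeonhole

open Finset

theorem two_mul_card_le_two_mul_card_add_card_collisions {α β : Type*} [Fintype β] [DecidableEq β]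
    (s : Finset α) (f : α → β) :
    2 * #s ≤ 2 * Fintype.card β + #{p ∈ s.offDiag | f p.1 = f p.2} := by
  classical
  have collisions_fiber (b : β) :
      {p ∈ {p ∈ s.offDiag | f p.1 = f p.2} | f p.1 = b} =
        ({a ∈ s | f a = b} : Finset α).offDiag := by
    ext
    simp only [mem_filter, mem_offDiag]
    grind
  have two_mul_le (k : ℕ) : 2 * k ≤ 2 + (k * k - k) := by
    rw [← Nat.mul_sub_one]
    rcases k with _ | _ | k
    · simp
    · simp
    · simp only [Nat.add_sub_cancel]
      nlinarith
  calc 2 * #s = ∑ b, 2 * #{a ∈ s | f a = b} := by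
        rw [← mul_sum, ← card_eq_sum_card_fiberwise fun _ _ => mem_coe.2 (mem_univ _)]
    _ ≤ ∑ b, (2 + #({a ∈ s | f a = b} : Finset α).offDiag) :=
        sum_le_sum fun b _ => (two_mul_le _).trans_eq (by rw [offDiag_card])
    _ = 2 * Fintype.card β + #{p ∈ s.offDiag | f p.1 = f p.2} := by
        rw [sum_add_distrib, card_eq_sum_card_fiberwise (t := univ) (f := fun p => f p.1)
          fun _ _ => mem_coe.2 (mem_univ _)]
        simp only [collisions_fiber, sum_const, card_univ, smul_eq_mul, mul_comm]

end Pigeonhole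

section Subgroups

variable {G : Type*} [Group G] [Finite G]

theorem two_mul_card_le_card_of_lt {H K : Subgroup G} (h : H < K) :
    2 * Nat.card H ≤ Nat.card K := by
  obtain ⟨k, hk⟩ := Subgroup.card_dvd_of_le h.le
  have hlt : Nat.card H < Nat.card K := Set.ncard_lt_ncard h
  have hk_two : 2 ≤ k := by
    rw [hk] at hlt
    exact one_lt_of_lt_mul_right hlt
  rw [hk, mul_comm]
  exact Nat.mul_le_mul_left _ hk_two

theorem eq_top_of_card_lt_two_mul_card {H : Subgroup G} (h : Nat.card G < 2 * Nat.card H) :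
    H = ⊤ := by
  by_contra hne
  have := two_mul_card_le_card_of_lt (lt_top_iff_ne_top.2 hne)
  rw [Subgroup.card_top] at this
  omega

theorem mul_card_le_mul_card_of_mul_index_le {H K : Subgroup G} {a b : ℕ}
    (h : a * H.index ≤ b * K.index) : a * Nat.card K ≤ b * Nat.card H := by
  refine Nat.le_of_mul_le_mul_right ?_ (Nat.card_pos (α := G))
  calc a * Nat.card K * Nat.card G = Nat.card K * Nat.card H * (a * H.index) := by
        rw [← H.card_mul_index]; ring
    _ ≤ Nat.card K * Nat.card H * (b * K.index) := Nat.mul_le_mul_left _ h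
    _ = b * Nat.card H * Nat.card G := by rw [← K.card_mul_index]; ring

end Subgroups

section Conjugates

variable {G : Type*} [Group G]

theorem ncard_conjugatesOf (t : G) :
    (conjugatesOf t).ncard = (Subgroup.centralizer {t}).index := by
  have h_orbit : conjugatesOf t = MulAction.orbit (ConjAct G) t := by
    ext
    rw [ConjAct.mem_orbit_conjAct, isConj_comm, conjugatesOf, Set.mem_ofPred_eq]
  calc (conjugatesOf t).ncard = (MulAction.stabilizer (ConjAct G) t).index := by
        rw [h_orbit, MulAction.index_stabilizer]
    _ = ((MulAction.stabilizer (ConjAct G) t).comap ConjAct.toConjAct.toMonoidHom).index :=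
        (Subgroup.index_comap_of_surjective _ ConjAct.toConjAct.surjective).symm
    _ = (Subgroup.centralizer {t}).index :=
        congrArg Subgroup.index (Subgroup.centralizer_eq_comap_stabilizer t).symm

theorem mul_self_eq_one_of_mem_conjugatesOf {t u : G} (ht : t * t = 1) (hu : u ∈ conjugatesOf t) :
    u * u = 1 := by
  obtain ⟨c, rfl⟩ := isConj_iff.1 hu
  rw [conj_mul, ht, mul_one, mul_inv_cancel]

end Conjugates

section Miller

variable {H G : Type*} [Group H] [Group G] {φ ι : H →* G}

theorem commute_of_map_eq_inv (hι : Function.Injective ι) {s h : H} (hs : φ s = (ι s)⁻¹)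
    (hh : φ h = (ι h)⁻¹) (hsh : φ (s * h) = (ι (s * h))⁻¹) : Commute s h := by
  refine hι (inv_injective ?_)
  rw [← hsh, map_mul, map_mul, hs, hh, mul_inv_rev]

variable [Finite H]

theorem mem_center_of_map_eq_inv (hι : Function.Injective ι)
    (hcard : 3 * Nat.card H < 4 * {h | φ h = (ι h)⁻¹}.ncard) {s : H} (hs : φ s = (ι s)⁻¹) :
    s ∈ Subgroup.center H := by
  set S : Set H := {h | φ h = (ι h)⁻¹}
  have h_inter : (S ∩ (s * ·) ⁻¹' S).ncard ≤ Nat.card (Subgroup.centralizer {s}) :=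
    Set.ncard_le_ncard fun h hh => Subgroup.mem_centralizer_singleton_iff.2
      (commute_of_map_eq_inv hι hs hh.1 hh.2).symm
  have h_preimage : ((s * ·) ⁻¹' S).ncard = S.ncard :=
    Set.ncard_preimage_of_injective_subset_range (mul_right_injective s)
      ((mul_left_surjective s).range_eq ▸ Set.subset_univ S)
  have h_union := Set.ncard_union_add_ncard_inter S ((s * ·) ⁻¹' S)
  have h_le := Set.ncard_le_card (S ∪ (s * ·) ⁻¹' S)
  have h_top : Subgroup.centralizer {s} = ⊤ := eq_top_of_card_lt_two_mul_card (by omega)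
  exact Subgroup.centralizer_eq_top_iff_subset.1 h_top rfl

/-- Miller's theorem, with `ι` present so that `φ` need not map a subgroup `H` of `G` to itself. -/
theorem isMulCommutative_of_three_mul_card_lt (hι : Function.Injective ι)
    (hcard : 3 * Nat.card H < 4 * {h | φ h = (ι h)⁻¹}.ncard) : IsMulCommutative H := by
  have h_le : {h | φ h = (ι h)⁻¹}.ncard ≤ Nat.card (Subgroup.center H) :=
    Set.ncard_le_ncard fun _ hs => mem_center_of_map_eq_inv hι hcard hs
  exact Subgroup.center_eq_top_iff.1 (eq_top_of_card_lt_two_mul_card (by omega))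

end Miller

section InvertingInvolutions

variable {G : Type*} [Group G]

/-- The involutions inverting `x`, which are the first components of the pairs `(u, v)` of
involutions with `u⁻¹ * v = x`. For uniformity, `u = 1` is also allowed. -/
def invertingInvolutions (x : G) : Set G := {u | u * u = 1 ∧ SemiconjBy u x x⁻¹}

theorem mem_invertingInvolutions_inv_mul {u v : G} (hu : u * u = 1) (hv : v * v = 1) :
    u ∈ invertingInvolutions (u⁻¹ * v) := by
  refine ⟨hu, ?_⟩
  rw [SemiconjBy, mul_inv_cancel_left, mul_inv_rev, inv_inv, mul_assoc, hu, mul_one,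
    inv_eq_of_mul_eq_one_left hv]

theorem inv_mul_mem_centralizer_of_mem_invertingInvolutions {u v x : G}
    (hu : u ∈ invertingInvolutions x) (hv : v ∈ invertingInvolutions x) :
    u⁻¹ * v ∈ Subgroup.centralizer {x} :=
  Subgroup.mem_centralizer_singleton_iff.2 (hu.2.inv_symm_left.mul_left hv.2)

theorem invertingInvolutions_subset_image {u x : G} (hu : u ∈ invertingInvolutions x) :
    invertingInvolutions x ⊆ (fun h : Subgroup.centralizer {x} => u * h) ''
      {h | MulAut.conj u h = (h : G)⁻¹} := by
  intro v hv
  refine ⟨⟨u⁻¹ * v, inv_mul_mem_centralizer_of_mem_invertingInvolutions hu hv⟩, ?_,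
    mul_inv_cancel_left u v⟩
  exact mul_inv_eq_of_eq_mul (mem_invertingInvolutions_inv_mul hu.1 hv.1).2

variable [Finite G]

theorem ncard_invertingInvolutions_le {u x : G} (hu : u ∈ invertingInvolutions x) :
    (invertingInvolutions x).ncard ≤
      {h : Subgroup.centralizer {x} | MulAut.conj u h = (h : G)⁻¹}.ncard :=
  (Set.ncard_le_ncard (invertingInvolutions_subset_image hu)).trans Set.ncard_image_le

theorem ncard_invertingInvolutions_le_card_centralizer (x : G) :
    (invertingInvolutions x).ncard ≤ Nat.card (Subgroup.centralizer {x}) := by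
  obtain h | ⟨u, hu⟩ := (invertingInvolutions x).eq_empty_or_nonempty
  · simp [h]
  · exact (ncard_invertingInvolutions_le hu).trans (Set.ncard_le_card _)

theorem four_mul_ncard_invertingInvolutions_le {x : G}
    (hx : ¬ IsMulCommutative (Subgroup.centralizer {x})) :
    4 * (invertingInvolutions x).ncard ≤ 3 * Nat.card (Subgroup.centralizer {x}) := by
  obtain h | ⟨u, hu⟩ := (invertingInvolutions x).eq_empty_or_nonempty
  · simp [h]
  · refine (Nat.mul_le_mul_left 4 (ncard_invertingInvolutions_le hu)).trans
      (not_lt.1 fun h => hx ?_)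
    exact isMulCommutative_of_three_mul_card_lt
      (φ := (MulAut.conj u).toMonoidHom.comp (Subgroup.subtype _)) (Subgroup.subtype_injective _) h

variable {N : Subgroup G} {B : ℕ}

open Finset in
theorem card_collisions_le [DecidableEq (G ⧸ N)] {K : Finset G}
    (hK : ∀ u ∈ K, u * u = 1) (hB : ∀ x ∈ N, x ≠ 1 → (invertingInvolutions x).ncard ≤ B) :
    #{p ∈ K.offDiag | (p.1 : G ⧸ N) = p.2} ≤ B * Nat.card N := by
  classical
  cases nonempty_fintype G
  have h_card : #((N : Set G).toFinset.erase 1) ≤ Nat.card N := by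
    rw [← SetLike.coe_sort_coe, Nat.card_coe_set_eq, Set.ncard_eq_toFinset_card']
    exact card_erase_le
  refine (card_le_mul_card_image_of_maps_to (f := fun p => p.1⁻¹ * p.2)
    (t := (N : Set G).toFinset.erase 1) (fun p hp => ?_) B fun x hx => ?_).trans
    (Nat.mul_le_mul_left B h_card)
  · rw [mem_filter, mem_offDiag, QuotientGroup.eq] at hp
    rw [mem_erase, Set.mem_toFinset]
    exact ⟨mt inv_mul_eq_one.1 hp.1.2.2, hp.2⟩
  · rw [mem_erase, Set.mem_toFinset] at hx
    refine le_trans ?_ (hB x hx.2 hx.1)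
    rw [Set.ncard_eq_toFinset_card']
    refine card_le_card_of_injOn Prod.fst ?_ ?_
    · rintro ⟨u, v⟩ h
      simp only [mem_coe, mem_filter, mem_offDiag] at h
      rw [mem_coe, Set.mem_toFinset, ← h.2]
      exact mem_invertingInvolutions_inv_mul (hK u h.1.1.1) (hK v h.1.1.2.1)
    · rintro ⟨u, v⟩ h ⟨u', v'⟩ h' rfl
      rw [mem_coe, mem_filter] at h h'
      exact Prod.ext rfl (mul_left_cancel (h.2.trans h'.2.symm))

theorem two_mul_ncard_le_two_mul_index_add {K : Set G} (hK : ∀ u ∈ K, u * u = 1)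
    (hB : ∀ x ∈ N, x ≠ 1 → (invertingInvolutions x).ncard ≤ B) :
    2 * K.ncard ≤ 2 * N.index + B * Nat.card N := by
  classical
  cases nonempty_fintype G
  rw [Set.ncard_eq_toFinset_card', Subgroup.index, Nat.card_eq_fintype_card]
  exact (two_mul_card_le_two_mul_card_add_card_collisions K.toFinset QuotientGroup.mk).trans
    (Nat.add_le_add_left (card_collisions_le (by simpa using hK) hB) _)

end InvertingInvolutions

section StronglySelfCentralizing

variable {G : Type*} [Group G] {N : Subgroup G}

/-- A subgroup is strongly self-centralizing if it is the centralizer of each of its nontrivial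
elements. Such a subgroup is abelian, and dihedral groups show that the involutions inverting one of
its elements may be as numerous as the subgroup itself. -/
def IsStronglySelfCentralizing (N : Subgroup G) : Prop :=
  ∀ x ∈ N, x ≠ 1 → Subgroup.centralizer {x} = N

namespace IsStronglySelfCentralizing

theorem mem_of_commute (hN : IsStronglySelfCentralizing N) {x w : G}
    (hx : x ∈ N) (hx1 : x ≠ 1) (h : Commute w x) : w ∈ N :=
  hN x hx hx1 ▸ Subgroup.mem_centralizer_singleton_iff.2 h

theorem commute_of_mem (hN : IsStronglySelfCentralizing N) {x y : G}
    (hx : x ∈ N) (hy : y ∈ N) : Commute x y := by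
  obtain rfl | hy1 := eq_or_ne y 1
  · exact Commute.one_right x
  · exact Subgroup.mem_centralizer_singleton_iff.1 ((hN y hy hy1).symm ▸ hx)

theorem conj_mem_of_mem_invertingInvolutions (hN : IsStronglySelfCentralizing N)
    {x u a : G} (hx : x ∈ N) (hx1 : x ≠ 1) (hu : u ∈ invertingInvolutions x) (ha : a ∈ N) :
    u * a * u⁻¹ ∈ N := by
  refine hN.mem_of_commute (N.inv_mem hx) (inv_ne_one.2 hx1) ?_
  rw [← mul_inv_eq_of_eq_mul hu.2]
  exact (Commute.conj_iff u).2 (hN.commute_of_mem ha hx)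

theorem semiconjBy_inv_of_mem_invertingInvolutions (hN : IsStronglySelfCentralizing N)
    {x u a : G} (hx : x ∈ N) (hx1 : x ≠ 1) (hu : u ∈ invertingInvolutions x) (huN : u ∉ N)
    (ha : a ∈ N) : SemiconjBy u a a⁻¹ := by
  have h_conj := hN.conj_mem_of_mem_invertingInvolutions hx hx1 hu ha
  have h_commute : Commute u (u * a * u⁻¹ * a) := by
    have h_inv : u⁻¹ = u := inv_eq_of_mul_eq_one_left hu.1
    calc u * (u * a * u⁻¹ * a) = u * (a * (u * a * u⁻¹)) := by
          rw [(hN.commute_of_mem h_conj ha).eq]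
      _ = u * a * (u * a * u⁻¹) := mul_assoc _ _ _ |>.symm
      _ = u * a * u⁻¹ * a * u := by simp only [h_inv, mul_assoc]
  have h_one : u * a * u⁻¹ * a = 1 :=
    by_contra fun h => huN (hN.mem_of_commute (N.mul_mem h_conj ha) h h_commute)
  exact mul_inv_eq_iff_eq_mul.1 (eq_inv_of_mul_eq_one_left h_one)

theorem mem_of_mem_invertingInvolutions_of_mem (hN : IsStronglySelfCentralizing N) {x y u v : G}
    (hx : x ∈ N) (hx1 : x ≠ 1) (hy : y ∈ N) (hy1 : y ≠ 1) (hu : u ∈ invertingInvolutions x)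
    (hv : v ∈ invertingInvolutions y) (huN : u ∈ N) : v ∈ N := by
  by_contra hvN
  have h_inv : x = x⁻¹ := mul_right_cancel ((hN.commute_of_mem huN hx).eq.symm.trans hu.2)
  have h_commute : SemiconjBy v x x⁻¹ :=
    hN.semiconjBy_inv_of_mem_invertingInvolutions hy hy1 hv hvN hx
  rw [← h_inv] at h_commute
  exact hvN (hN.mem_of_commute hx hx1 h_commute)

theorem inv_mul_mem_of_mem_invertingInvolutions (hN : IsStronglySelfCentralizing N) {x y u v : G}
    (hx : x ∈ N) (hx1 : x ≠ 1) (hy : y ∈ N) (hy1 : y ≠ 1) (hu : u ∈ invertingInvolutions x)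
    (hv : v ∈ invertingInvolutions y) : u⁻¹ * v ∈ N := by
  by_cases huN : u ∈ N
  · exact N.mul_mem (N.inv_mem huN)
      (hN.mem_of_mem_invertingInvolutions_of_mem hx hx1 hy hy1 hu hv huN)
  have hvN : v ∉ N := mt (hN.mem_of_mem_invertingInvolutions_of_mem hy hy1 hx hx1 hv hu) huN
  have hvx := hN.semiconjBy_inv_of_mem_invertingInvolutions hy hy1 hv hvN hx
  exact hN.mem_of_commute hx hx1 (hu.2.inv_symm_left.mul_left hvx)

theorem exists_coset_of_mem_invertingInvolutions (hN : IsStronglySelfCentralizing N) :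
    ∃ b : G ⧸ N, ∀ x ∈ N, x ≠ 1 → ∀ u ∈ invertingInvolutions x, (u : G ⧸ N) = b := by
  by_cases h : ∃ x ∈ N, x ≠ 1 ∧ (invertingInvolutions x).Nonempty
  · obtain ⟨x, hx, hx1, u, hu⟩ := h
    exact ⟨u, fun y hy hy1 v hv => QuotientGroup.eq.2
      (hN.inv_mul_mem_of_mem_invertingInvolutions hy hy1 hx hx1 hv hu)⟩
  · exact ⟨(1 : G), fun x hx hx1 u hu => absurd ⟨x, hx, hx1, u, hu⟩ h⟩

theorem ncard_add_one_le_index_add_card [Finite G] (hN : IsStronglySelfCentralizing N)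
    {K : Set G} (hK : ∀ u ∈ K, u * u = 1) :
    K.ncard + 1 ≤ N.index + Nat.card N := by
  obtain ⟨b, hb⟩ := hN.exists_coset_of_mem_invertingInvolutions
  set f : G → G ⧸ N := QuotientGroup.mk
  have h_inside : (K ∩ f ⁻¹' {b}).ncard ≤ Nat.card N :=
    calc (K ∩ f ⁻¹' {b}).ncard ≤ Nat.card (f ⁻¹' {b}) := Set.ncard_le_ncard Set.inter_subset_right
      _ = Nat.card N := (QuotientGroup.card_preimage_mk N {b}).trans (by simp)
  have h_outside : (K \ f ⁻¹' {b}).ncard ≤ ({b}ᶜ : Set (G ⧸ N)).ncard := by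
    refine Set.ncard_le_ncard_of_injOn f (fun u hu => hu.2) fun u hu v hv huv => ?_
    by_contra hne
    exact hu.2 (hb (u⁻¹ * v) (QuotientGroup.eq.1 huv) (mt inv_mul_eq_one.1 hne) u
      (mem_invertingInvolutions_inv_mul (hK u hu.1) (hK v hv.1)))
  have h_compl : ({b} : Set (G ⧸ N)).ncard + ({b}ᶜ : Set (G ⧸ N)).ncard = N.index :=
    Set.ncard_add_ncard_compl {b}
  have h_split := Set.ncard_inter_add_ncard_sdiff_eq_ncard K (f ⁻¹' {b})
  rw [Set.ncard_singleton] at h_compl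
  omega

end IsStronglySelfCentralizing

end StronglySelfCentralizing

section Index

variable {G : Type*} [Group G] [Finite G] {N : Subgroup G} {t : G}

theorem IsStronglySelfCentralizing.eight_mul_index_centralizer_le
    (hN : IsStronglySelfCentralizing N) (hcard : Nat.card N ^ 3 ≤ Nat.card G) (ht : t * t = 1) :
    8 * (Subgroup.centralizer {t}).index ≤ 11 * N.index := by
  have h_class := hN.ncard_add_one_le_index_add_card
    fun _ => mul_self_eq_one_of_mem_conjugatesOf ht
  rw [ncard_conjugatesOf] at h_class
  have h_sq : Nat.card N * Nat.card N ≤ N.index := by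
    refine Nat.le_of_mul_le_mul_left ?_ (Nat.card_pos (α := N))
    rw [N.card_mul_index]
    linarith
  have h_error : 8 * Nat.card N ≤ 3 * (Nat.card N * Nat.card N) + 8 := by
    zify
    nlinarith [sq_nonneg (3 * (Nat.card N : ℤ) - 4)]
  omega

theorem eight_mul_index_centralizer_le_of_ncard_invertingInvolutions_le (ht : t * t = 1) {B : ℕ}
    (hB : ∀ x ∈ N, x ≠ 1 → 4 * (invertingInvolutions x).ncard ≤ B)
    (hBN : Nat.card N * Nat.card N * B ≤ 3 * Nat.card G) :
    8 * (Subgroup.centralizer {t}).index ≤ 11 * N.index := by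
  have h_class := two_mul_ncard_le_two_mul_index_add (B := B / 4)
    (fun _ => mul_self_eq_one_of_mem_conjugatesOf ht) fun x hx hx1 => by
      have := hB x hx hx1
      omega
  rw [ncard_conjugatesOf] at h_class
  have h_index : B * Nat.card N ≤ 3 * N.index := by
    refine Nat.le_of_mul_le_mul_left ?_ (Nat.card_pos (α := N))
    rw [← N.card_mul_index] at hBN
    linarith
  have h_collisions : 4 * (B / 4 * Nat.card N) ≤ 3 * N.index :=
    calc 4 * (B / 4 * Nat.card N) = B / 4 * 4 * Nat.card N := by ring
      _ ≤ B * Nat.card N := Nat.mul_le_mul_right _ (Nat.div_mul_le_self B 4)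
      _ ≤ 3 * N.index := h_index
  omega

variable {b : ℕ}

theorem eight_mul_index_centralizer_le_of_lt_centralizer
    (ht : t * t = 1) (hb : ∀ x ∈ N, x ≠ 1 → Nat.card (Subgroup.centralizer {x}) ≤ b)
    (hbG : b ^ 3 ≤ Nat.card G) {x : G} (hx : x ∈ N) (hx1 : x ≠ 1)
    (hNx : N < Subgroup.centralizer {x}) :
    8 * (Subgroup.centralizer {t}).index ≤ 11 * N.index := by
  have h_half : 2 * Nat.card N ≤ b := (two_mul_card_le_card_of_lt hNx).trans (hb x hx hx1)
  refine eight_mul_index_centralizer_le_of_ncard_invertingInvolutions_le ht (B := 4 * b)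
    (fun y hy hy1 => Nat.mul_le_mul_left 4
      ((ncard_invertingInvolutions_le_card_centralizer y).trans (hb y hy hy1))) ?_
  calc Nat.card N * Nat.card N * (4 * b) = 2 * Nat.card N * (2 * Nat.card N) * b := by ring
    _ ≤ b * b * b := by gcongr
    _ = b ^ 3 := by ring
    _ ≤ 3 * Nat.card G := by omega

theorem four_mul_ncard_invertingInvolutions_le_of_not_isMulCommutative
    (hcomm : ¬ IsMulCommutative N)
    (hb : ∀ x ∈ N, x ≠ 1 → Nat.card (Subgroup.centralizer {x}) ≤ b) {z : G} (hz : z ∈ N)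
    (hz1 : z ≠ 1) (hNz : N ≤ Subgroup.centralizer {z}) {x : G} (hx : x ∈ N) (hx1 : x ≠ 1) :
    4 * (invertingInvolutions x).ncard ≤ 3 * b := by
  by_cases hC : IsMulCommutative (Subgroup.centralizer {x})
  · have hzx : z ∈ Subgroup.centralizer {x} :=
      Subgroup.mem_centralizer_singleton_iff.2
        (Subgroup.mem_centralizer_singleton_iff.1 (hNz hx)).symm
    have h_le : Subgroup.centralizer {x} ≤ Subgroup.centralizer {z} := fun y hy =>
      Subgroup.mem_centralizer_singleton_iff.2 (setLike_mul_comm hy hzx)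
    have h_ne : Subgroup.centralizer {x} ≠ Subgroup.centralizer {z} := fun h =>
      hcomm (.of_setLike_mul_comm fun y hy w hw =>
        setLike_mul_comm (h.symm ▸ hNz hy) (h.symm ▸ hNz hw))
    have h_half := two_mul_card_le_card_of_lt (h_le.lt_of_ne h_ne)
    have h_ncard := ncard_invertingInvolutions_le_card_centralizer x
    have hbz := hb z hz hz1
    omega
  · exact (four_mul_ncard_invertingInvolutions_le hC).trans (Nat.mul_le_mul_left 3 (hb x hx hx1))

theorem eight_mul_index_centralizer_le_of_not_isMulCommutative (ht : t * t = 1)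
    (hcomm : ¬ IsMulCommutative N)
    (hb : ∀ x ∈ N, x ≠ 1 → Nat.card (Subgroup.centralizer {x}) ≤ b) (hbG : b ^ 3 ≤ Nat.card G)
    {z : G} (hz : z ∈ N) (hz1 : z ≠ 1) (hNz : N ≤ Subgroup.centralizer {z}) :
    8 * (Subgroup.centralizer {t}).index ≤ 11 * N.index := by
  have h_card : Nat.card N ≤ b := (Subgroup.card_le_of_le hNz).trans (hb z hz hz1)
  refine eight_mul_index_centralizer_le_of_ncard_invertingInvolutions_le ht (B := 3 * b)
    (fun x => four_mul_ncard_invertingInvolutions_le_of_not_isMulCommutative hcomm hb hz hz1 hNz) ?_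
  calc Nat.card N * Nat.card N * (3 * b) ≤ b * b * (3 * b) := by gcongr
    _ = 3 * b ^ 3 := by ring
    _ ≤ 3 * Nat.card G := Nat.mul_le_mul_left 3 hbG

end Index

theorem exists_ne_one_le_centralizer_of_center_ne_bot {G : Type*} [Group G] {N : Subgroup G}
    (hZ : Subgroup.center N ≠ ⊥) : ∃ z ∈ N, z ≠ 1 ∧ N ≤ Subgroup.centralizer {z} := by
  obtain ⟨⟨⟨z, hz⟩, hzZ⟩, hz1⟩ := Subgroup.ne_bot_iff_exists_ne_one.1 hZ
  refine ⟨z, hz, by simpa using hz1, fun y hy => Subgroup.mem_centralizer_singleton_iff.2 ?_⟩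
  exact congrArg Subtype.val (Subgroup.mem_center_iff.1 hzZ ⟨y, hy⟩)

theorem lt_sqrt_mul_of_eight_mul_le {n c : ℕ} {r : ℝ} (hc : 0 < c) (h : 8 * n ≤ 11 * c)
    (hr : 2 ≤ r) : (n : ℝ) < √r * c := by
  have h_real : (8 * n : ℝ) ≤ 11 * c := by exact_mod_cast h
  calc (n : ℝ) ≤ 11 / 8 * c := by linarith
    _ < √r * c := by
      gcongr
      exact Real.lt_sqrt_of_sq_lt (by linarith)

theorem two_le_two_mul_sub_one_div {z : ℝ} (hz : 1 < z) : 2 ≤ (2 * z - 1) / (z - 1) := by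
  rw [le_div_iff₀ (by linarith)]
  linarith

theorem theorem8_general {G : Type*} [Group G] [Finite G] {t : G} (ht : t * t = 1)
    {N : Subgroup G} (hZ : Subgroup.center N ≠ ⊥)
    (hcent : ∀ x ∈ N, x ≠ 1 → Nat.card (Subgroup.centralizer {x}) ^ 3 ≤ Nat.card G) :
    8 * Nat.card N ≤ 11 * Nat.card (Subgroup.centralizer {t}) := by
  refine mul_card_le_mul_card_of_mul_index_le ?_
  obtain ⟨z, hz, hz1, hNz⟩ := exists_ne_one_le_centralizer_of_center_ne_bot hZ
  have hb (x) (hx : x ∈ N) (hx1 : x ≠ 1) :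
      Nat.card (Subgroup.centralizer {x}) ≤ Nat.nthRoot 3 (Nat.card G) :=
    (Nat.le_nthRoot_iff three_ne_zero).2 (hcent x hx hx1)
  have hbG : Nat.nthRoot 3 (Nat.card G) ^ 3 ≤ Nat.card G :=
    Nat.pow_nthRoot_le (.inl three_ne_zero)
  by_cases hcomm : IsMulCommutative N
  · by_cases hN : IsStronglySelfCentralizing N
    · exact hN.eight_mul_index_centralizer_le (hN z hz hz1 ▸ hcent z hz hz1) ht
    · obtain ⟨x, hx, hx1, hxN⟩ : ∃ x ∈ N, x ≠ 1 ∧ Subgroup.centralizer {x} ≠ N := by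
        simpa [IsStronglySelfCentralizing] using hN
      have hNx : N ≤ Subgroup.centralizer {x} := fun y hy =>
        Subgroup.mem_centralizer_singleton_iff.2 (setLike_mul_comm hy hx)
      exact eight_mul_index_centralizer_le_of_lt_centralizer ht hb hbG hx hx1
        (hNx.lt_of_ne hxN.symm)
  · exact eight_mul_index_centralizer_le_of_not_isMulCommutative ht hcomm hb hbG hz hz1 hNz

theorem theorem8 {G : Type*} [Group G] [Finite G] (hG : Even (Nat.card G))
    (t : G) (ht : orderOf t = 2)
    (N : Subgroup G) (hN : N ≠ ⊥) (hnil : Group.IsNilpotent N)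
    (hcent : ∀ x ∈ N, x ≠ 1 →
      Nat.card (Subgroup.centralizer ({x} : Set G)) ^ 3 < Nat.card G) :
    (IsMulCommutative N →
      (Nat.card N : ℝ) <
        Real.sqrt 2 * (Nat.card (Subgroup.centralizer ({t} : Set G)) : ℝ)) ∧
    (¬ IsMulCommutative N →
      (Nat.card N : ℝ) <
        Real.sqrt ((2 * (Nat.card (Subgroup.center N) : ℝ) - 1) /
            ((Nat.card (Subgroup.center N) : ℝ) - 1)) *
          (Nat.card (Subgroup.centralizer ({t} : Set G)) : ℝ)) := by
  have : Nontrivial N := N.nontrivial_iff_ne_bot.2 hN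
  have hZ : Subgroup.center N ≠ ⊥ := Group.IsNilpotent.center_ne_bot N
  have hZ_card : (1 : ℝ) < Nat.card (Subgroup.center N) :=
    mod_cast (Subgroup.one_lt_card_iff_ne_bot _).2 hZ
  have ht_sq : t * t = 1 := by rw [← sq, ← ht, pow_orderOf_eq_one]
  have h_card := theorem8_general ht_sq hZ fun x hx hx1 => (hcent x hx hx1).le
  exact ⟨fun _ => lt_sqrt_mul_of_eight_mul_le Nat.card_pos h_card le_rfl,
    fun _ => lt_sqrt_mul_of_eight_mul_le Nat.card_pos h_card (two_le_two_mul_sub_one_div hZ_card)⟩
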